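/- Let $K$ be a (commutative) field, $n\ge 2$, let $\Lambda=K\langle x_1,\dots,x_n\rangle$ be the free algebra, and let $\mathbb{L}=L_K(1,n)$ be the Leavitt algebra, i.e. the unital $K$-algebra generated by $x_1,\dots,x_n,x_1^*,\dots,x_n^*$ subject to $\sum_{i=1}^n x_ix_i^*=1$, $x_i^*x_i=1$, and $x_j^*x_i=0$ for $j\neq i$; elements of $\Lambda$ are regarded as elements of $\mathbb{L}$ through the canonical map $x_i\mapsto x_i$. Let $\lambda\in\Lambda$ be comonic, i.e. have constant term $1$. A right factor of $\lambda$ is a $\delta\in\Lambda$ with $\lambda=\gamma\delta$ for some $\gamma\in\Lambda$. (1) The map $\delta\mapsto\mathbb{L}\delta$ induces a bijection from the set of right factors of $\lambda$, taken up to nonzero scalars from $K$, onto the set of left ideals of $\mathbb{L}$ containing $\lambda$. (2) The principal left ideals of $\Lambda$ containing $\lambda$ form a sublattice ${\bf L}(\Lambda\lambda,\Lambda)$ of the lattice of left ideals of $\Lambda$ (with sum and intersection), this lattice is distributive, and it is isomorphic to the lattice of submodules of the left $\mathbb{L}$-module $\mathbb{L}/\mathbb{L}\lambda$, by a lattice isomorphism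 under which $\mathbb{L}\delta/\mathbb{L}\lambda$ corresponds to $\Lambda\delta$ for every right factor $\delta$ of $\lambda$. -/

import Mathlib

/-- A polynomial in the free algebra `K⟨x₁, …, xₙ⟩` is *comonic* if its constant term is `1`
(`FreeAlgebra.algebraMapInv` is the `K`-algebra map sending every variable to `0`). -/
def IsComonic {K : Type*} [Field K] {n : ℕ} (p : FreeAlgebra K (Fin n)) : Prop :=
  FreeAlgebra.algebraMapInv p = 1

/-- The defining relations of the Leavitt algebra of module type `(1, n)`, on generators
`xᵢ` (`Sum.inl i`) and `xᵢ*` (`Sum.inr i`). -/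
inductive LeavittRel (K : Type*) [Field K] (n : ℕ) :
    FreeAlgebra K (Fin n ⊕ Fin n) → FreeAlgebra K (Fin n ⊕ Fin n) → Prop
  | sum_mul_star :
      LeavittRel K n
        (∑ i : Fin n, FreeAlgebra.ι K (Sum.inl i) * FreeAlgebra.ι K (Sum.inr i)) 1
  | star_mul (i j : Fin n) :
      LeavittRel K n
        (FreeAlgebra.ι K (Sum.inr j) * FreeAlgebra.ι K (Sum.inl i)) (if j = i then 1 else 0)

/-- The Leavitt algebra `L_K(1, n)`: the `K`-algebra generated by `xᵢ, xᵢ*` (`1 ≤ i ≤ n`)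
subject to `∑ xᵢ xᵢ* = 1`, `xᵢ* xᵢ = 1` and `xⱼ* xᵢ = 0` for `j ≠ i`. -/
def LeavittAlgebra (K : Type*) [Field K] (n : ℕ) : Type _ :=
  RingQuot (LeavittRel K n)

noncomputable instance (K : Type*) [Field K] (n : ℕ) : Ring (LeavittAlgebra K n) :=
  inferInstanceAs (Ring (RingQuot (LeavittRel K n)))

noncomputable instance (K : Type*) [Field K] (n : ℕ) : Algebra K (LeavittAlgebra K n) :=
  inferInstanceAs (Algebra K (RingQuot (LeavittRel K n)))

namespace LeavittAlgebra

/-- The generator `xᵢ` of the Leavitt algebra. -/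
noncomputable def x (K : Type*) [Field K] {n : ℕ} (i : Fin n) : LeavittAlgebra K n :=
  RingQuot.mkAlgHom K (LeavittRel K n) (FreeAlgebra.ι K (Sum.inl i))

/-- The generator `xᵢ*` of the Leavitt algebra. -/
noncomputable def xStar (K : Type*) [Field K] {n : ℕ} (i : Fin n) : LeavittAlgebra K n :=
  RingQuot.mkAlgHom K (LeavittRel K n) (FreeAlgebra.ι K (Sum.inr i))

/-- The canonical map from the free algebra `Λ = K⟨x₁, …, xₙ⟩` to the Leavitt algebra,
`xᵢ ↦ xᵢ`, through which elements of `Λ` are regarded as elements of the Leavitt algebra. -/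
noncomputable def ofFree (K : Type*) [Field K] (n : ℕ) :
    FreeAlgebra K (Fin n) →ₐ[K] LeavittAlgebra K n :=
  FreeAlgebra.lift K (fun i => x K i)

/-- The left ideal of the Leavitt algebra generated by a polynomial `p ∈ Λ`. -/
noncomputable def leftIdeal {K : Type*} [Field K] {n : ℕ} (p : FreeAlgebra K (Fin n)) :
    Submodule (LeavittAlgebra K n) (LeavittAlgebra K n) :=
  Submodule.span (LeavittAlgebra K n) {ofFree K n p}

end LeavittAlgebra

/-- The right factors of a polynomial `p`: those `d` with `p = c * d` for some polynomial `c`. -/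
def RightFactor {K : Type*} [Field K] {n : ℕ} (p : FreeAlgebra K (Fin n)) : Type _ :=
  {d : FreeAlgebra K (Fin n) // ∃ c : FreeAlgebra K (Fin n), p = c * d}

/-- Two right factors are identified if they differ by a nonzero scalar. -/
def rightFactorSetoid {K : Type*} [Field K] {n : ℕ} (p : FreeAlgebra K (Fin n)) :
    Setoid (RightFactor p) where
  r d e := ∃ k : K, k ≠ 0 ∧ e.1 = k • d.1
  iseqv :=
    { refl := fun d => ⟨1, one_ne_zero, (one_smul K d.1).symm⟩
      symm := by
        rintro d e ⟨k, hk, h⟩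
        exact ⟨k⁻¹, inv_ne_zero hk, by rw [h, smul_smul, inv_mul_cancel₀ hk, one_smul]⟩
      trans := by
        rintro d e f ⟨k, hk, h⟩ ⟨l, hl, h'⟩
        exact ⟨l * k, mul_ne_zero hl hk, by rw [h', h, smul_smul]⟩ }

/-- Right factors of `p` up to nonzero scalars. -/
def RightFactorClass {K : Type*} [Field K] {n : ℕ} (p : FreeAlgebra K (Fin n)) : Type _ :=
  Quotient (rightFactorSetoid p)

/-- The class of a right factor up to nonzero scalars. -/
def RightFactor.toClass {K : Type*} [Field K] {n : ℕ} {p : FreeAlgebra K (Fin n)}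
    (d : RightFactor p) : RightFactorClass p :=
  Quotient.mk (rightFactorSetoid p) d

/-! Write ε(f) for the constant term and ∂ⱼf for the transductions, so f = ε(f) + ∑ xⱼ ∂ⱼf. In 𝕃 one
has xⱼ* f = ε(f) xⱼ* + ∂ⱼf. Hence the polynomials in a left ideal of 𝕃 form a left ideal of Λ that
is stable under every ∂ⱼ on elements with ε = 0 (`TransductionClosed`). If such an ideal contains λ,
a shortest nonzero element has ε ≠ 0 and generates it, by a division algorithm
(`TransductionClosed.exists_minimal`). So for left ideals containing λ, principal means transduction
closed, and this property passes to sums and intersections.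

Contraction and extension are then mutually inverse. Modulo λ, xⱼ* is congruent to the polynomial
-∂ⱼλ, so a left ideal of 𝕃 containing λ is determined by its polynomials (`extension_contraction`).
Conversely 𝕃 acts on Λ/Λδ, which forces 𝕃δ ∩ Λ = Λδ (`exists_representation`).

For distributivity, let a = b + c with a ∈ A, b ∈ B, c ∈ C, and adjoin a central variable t. The
saturated ideal generated by all u + tv with u ∈ A, v ∈ B, u - v ∈ C is transduction closed. Gauss's
lemma and a degree count in t give it a generator free of t (`exists_unimodular_generator`). As a +
tb lies in the ideal, so does its t-coefficient b, and comparing coefficients yields b ∈ (A ∩ B) +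
(B ∩ C). -/

namespace FreeAlgebra

/-! ### Transductions and length in the free algebra -/

variable {R : Type*} [CommRing R] {α : Type*}

@[simp]
theorem algebraMapInv_ι (i : α) : algebraMapInv (ι R i) = 0 := by
  simp [algebraMapInv]

@[simp]
theorem algebraMapInv_algebraMap (r : R) :
    algebraMapInv (algebraMap R (FreeAlgebra R α) r) = r :=
  algebraMap_leftInverse r

/-- An induction principle for the free algebra using left multiplication by generators. -/
theorem induction_left {motive : FreeAlgebra R α → Prop}
    (algebraMap : ∀ r, motive (algebraMap R _ r))
    (add : ∀ f g, motive f → motive g → motive (f + g))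
    (ι_mul : ∀ i f, motive f → motive (ι R i * f)) (f : FreeAlgebra R α) : motive f := by
  have zero : motive 0 := by simpa using algebraMap 0
  -- `motive` is not assumed stable under scalars, so they are carried through the induction.
  have key : ∀ f, (∀ (r : R), motive (r • f)) → ∀ g : FreeAlgebra R α, ∀ r : R,
      motive (r • (g * f)) := by
    suffices ∀ g : FreeAlgebra R α, ∀ f, (∀ (r : R), motive (r • f)) →
        ∀ r : R, motive (r • (g * f)) from fun f hf g => this g f hf
    intro g
    induction g using FreeAlgebra.induction with
    | grade0 s =>
      intro f hf r
      rw [← Algebra.smul_def, smul_smul]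
      exact hf _
    | grade1 i =>
      intro f hf r
      rw [← mul_smul_comm]
      exact ι_mul _ _ (hf r)
    | add g h hg hh =>
      intro f hf r
      rw [add_mul, smul_add]
      exact add _ _ (hg f hf r) (hh f hf r)
    | mul g h hg hh =>
      intro f hf r
      rw [mul_assoc]
      exact hg _ (hh f hf) r
  simpa using key 1 (fun r => by simpa [Algebra.smul_def] using algebraMap r) f 1

section Transduction

variable [DecidableEq α]

/-- The algebra map packaging the augmentation, the transduction at `j` and the identity as an
upper triangular matrix. -/
noncomputable def transductionHom (R : Type*) [CommRing R] {α : Type*} [DecidableEq α] (j : α) :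
    FreeAlgebra R α →ₐ[R] Matrix (Fin 2) (Fin 2) (FreeAlgebra R α) :=
  lift R fun i => !![0, if i = j then 1 else 0; 0, ι R i]

theorem transductionHom_entries (j : α) (f : FreeAlgebra R α) :
    transductionHom R j f 0 0 = algebraMap R _ (algebraMapInv f) ∧
      transductionHom R j f 1 0 = 0 ∧ transductionHom R j f 1 1 = f := by
  induction f using FreeAlgebra.induction with
  | grade0 r => simp [Matrix.algebraMap_matrix_apply, algebraMapInv]
  | grade1 i => simp [transductionHom, algebraMapInv]
  | add f g hf hg => simp [hf, hg]
  | mul f g hf hg => simp [Matrix.mul_apply, Fin.sum_univ_two, hf, hg]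

/-- The left transduction at `j`: it sends `c + ∑ i, xᵢ * fᵢ` to `fⱼ`. -/
noncomputable def transduction (R : Type*) [CommRing R] {α : Type*} [DecidableEq α] (j : α) :
    FreeAlgebra R α →ₗ[R] FreeAlgebra R α where
  toFun f := transductionHom R j f 0 1
  map_add' f g := by simp
  map_smul' r f := by simp

/-- This twisted Leibniz rule is the upper right entry of a product of matrices with rows (ε, ∂ⱼ)
and (0, id). -/
theorem transduction_mul (j : α) (f g : FreeAlgebra R α) :
    transduction R j (f * g) = transduction R j f * g + algebraMapInv f • transduction R j g := by
  simp [transduction, Matrix.mul_apply, Fin.sum_univ_two, transductionHom_entries,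
    Algebra.smul_def, add_comm]

@[simp]
theorem transduction_algebraMap (j : α) (r : R) :
    transduction R j (algebraMap R _ r) = 0 := by
  simp [transduction, Matrix.algebraMap_matrix_apply]

theorem transduction_ι (i j : α) : transduction R j (ι R i) = if i = j then 1 else 0 := by
  simp [transduction, transductionHom]

theorem transduction_ι_mul (i j : α) (f : FreeAlgebra R α) :
    transduction R j (ι R i * f) = if i = j then f else 0 := by
  rw [transduction_mul, transduction_ι]
  split_ifs <;> simp

theorem transduction_mul_of_algebraMapInv_eq_zero {f : FreeAlgebra R α}
    (hf : algebraMapInv f = 0) (j : α) (g : FreeAlgebra R α) :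
    transduction R j (f * g) = transduction R j f * g := by
  rw [transduction_mul, hf, zero_smul, add_zero]

theorem eq_algebraMapInv_add_sum [Fintype α] (f : FreeAlgebra R α) :
    f = algebraMap R _ (algebraMapInv f) + ∑ i, ι R i * transduction R i f := by
  induction f using induction_left with
  | algebraMap r => simp
  | add f g hf hg =>
    conv_lhs => rw [hf, hg]
    simp only [map_add, mul_add, Finset.sum_add_distrib]
    abel
  | ι_mul i f _ => simp [transduction_ι_mul]

/-- The elements of the free algebra all of whose monomials have length less than `d`. -/
noncomputable def lengthLT (R : Type*) [CommRing R] (α : Type*) [DecidableEq α] :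
    ℕ → Submodule R (FreeAlgebra R α)
  | 0 => ⊥
  | d + 1 => ⨅ j, (lengthLT R α d).comap (transduction R j)

theorem mem_lengthLT_zero {f : FreeAlgebra R α} : f ∈ lengthLT R α 0 ↔ f = 0 := Iff.rfl

theorem mem_lengthLT_succ {d : ℕ} {f : FreeAlgebra R α} :
    f ∈ lengthLT R α (d + 1) ↔ ∀ j, transduction R j f ∈ lengthLT R α d := by
  simp [lengthLT]

theorem lengthLT_le_succ (d : ℕ) : lengthLT R α d ≤ lengthLT R α (d + 1) := by
  induction d with
  | zero => exact bot_le
  | succ d ih =>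
    intro f hf
    rw [mem_lengthLT_succ] at hf ⊢
    exact fun j => ih (hf j)

theorem lengthLT_mono : Monotone (lengthLT R α) :=
  monotone_nat_of_le_succ lengthLT_le_succ

theorem exists_mem_lengthLT (f : FreeAlgebra R α) : ∃ d, f ∈ lengthLT R α d := by
  induction f using induction_left with
  | algebraMap r => exact ⟨1, mem_lengthLT_succ.2 fun j => by simp⟩
  | add f g hf hg =>
    obtain ⟨d, hd⟩ := hf
    obtain ⟨e, he⟩ := hg
    exact ⟨max d e, add_mem (lengthLT_mono (le_max_left d e) hd)
      (lengthLT_mono (le_max_right d e) he)⟩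
  | ι_mul i f hf =>
    obtain ⟨d, hd⟩ := hf
    refine ⟨d + 1, mem_lengthLT_succ.2 fun j => ?_⟩
    rw [transduction_ι_mul]
    split_ifs
    · exact hd
    · exact zero_mem _

theorem eq_zero_of_transduction [Fintype α] {f : FreeAlgebra R α} (h0 : algebraMapInv f = 0)
    (h : ∀ j, transduction R j f = 0) : f = 0 := by
  rw [eq_algebraMapInv_add_sum f]
  simp [h0, h]

end Transduction

end FreeAlgebra

/-! ### Extension of scalars and Gauss's lemma -/

namespace FreeAlgebra

variable {R : Type*} [CommRing R] {α : Type*}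

section BaseChange

variable (S : Type*) [CommRing S] [Algebra R S]

/-- Extension of scalars of the free algebra. -/
noncomputable def baseChange : FreeAlgebra R α →ₐ[R] FreeAlgebra S α :=
  lift R (ι S)

@[simp]
theorem baseChange_ι (i : α) : baseChange S (ι R i) = ι S i := by
  simp [baseChange]

theorem baseChange_algebraMap (r : R) :
    baseChange S (algebraMap R (FreeAlgebra R α) r) = algebraMap S _ (algebraMap R S r) := by
  rw [AlgHom.commutes]
  rfl

theorem algebraMapInv_baseChange (f : FreeAlgebra R α) :
    algebraMapInv (baseChange S f) = algebraMap R S (algebraMapInv f) := by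
  induction f using induction_left with
  | algebraMap r => rw [baseChange_algebraMap, algebraMapInv_algebraMap, algebraMapInv_algebraMap]
  | add f g hf hg => simp [hf, hg]
  | ι_mul i f _ => simp

variable [DecidableEq α]

theorem transduction_baseChange (j : α) (f : FreeAlgebra R α) :
    transduction S j (baseChange S f) = baseChange S (transduction R j f) := by
  induction f using induction_left with
  | algebraMap r => rw [baseChange_algebraMap, transduction_algebraMap,
      transduction_algebraMap, map_zero]
  | add f g hf hg => simp [hf, hg]
  | ι_mul i f _ =>
    rw [map_mul, baseChange_ι, transduction_ι_mul, transduction_ι_mul]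
    split_ifs <;> simp

/-- Constant term and transductions commute with base change, so divisibility by `a` follows by
induction on length. -/
theorem exists_eq_smul_of_baseChange_quotient_eq_zero [Fintype α] {a : R} {f : FreeAlgebra R α}
    (hf : baseChange (R ⧸ Ideal.span {a}) f = 0) : ∃ g, f = a • g := by
  obtain ⟨d, hd⟩ := exists_mem_lengthLT f
  induction d generalizing f with
  | zero => exact ⟨0, by rw [mem_lengthLT_zero.1 hd, smul_zero]⟩
  | succ d ih =>
    have h0 : algebraMap R (R ⧸ Ideal.span {a}) (algebraMapInv f) = 0 := by
      rw [← algebraMapInv_baseChange, hf, map_zero]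
    obtain ⟨r, hr⟩ := Ideal.mem_span_singleton.1 (Ideal.Quotient.eq_zero_iff_mem.1 h0)
    have h1 (j : α) : ∃ g, transduction R j f = a • g :=
      ih (by rw [← transduction_baseChange, hf, map_zero]) (mem_lengthLT_succ.1 hd j)
    choose g hg using h1
    refine ⟨algebraMap R _ r + ∑ i, ι R i * g i, ?_⟩
    conv_lhs => rw [eq_algebraMapInv_add_sum f, hr]
    simp only [hg, smul_add, Finset.smul_sum, mul_smul_comm, map_mul,
      Algebra.smul_def a (algebraMap _ _ r)]

/-- Gauss's lemma: a prime of the coefficient ring stays prime in the free algebra. -/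
theorem exists_eq_smul_or_of_prime [Fintype α] {a : R} (ha : Prime a) {f g h : FreeAlgebra R α}
    (hfg : f * g = a • h) : (∃ f', f = a • f') ∨ ∃ g', g = a • g' := by
  have : (Ideal.span {a}).IsPrime := (Ideal.span_singleton_prime ha.ne_zero).2 ha
  have h0 : algebraMap R (R ⧸ Ideal.span {a}) a = 0 :=
    Ideal.Quotient.eq_zero_iff_mem.2 (Ideal.mem_span_singleton_self a)
  have : baseChange (R ⧸ Ideal.span {a}) f * baseChange (R ⧸ Ideal.span {a}) g = 0 := by
    rw [← map_mul, hfg, Algebra.smul_def, map_mul, baseChange_algebraMap, h0, map_zero, zero_mul]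
  rcases mul_eq_zero.1 this with h | h
  · exact .inl (exists_eq_smul_of_baseChange_quotient_eq_zero h)
  · exact .inr (exists_eq_smul_of_baseChange_quotient_eq_zero h)

end BaseChange

/-! ### Transduction closed left ideals -/

variable [DecidableEq α]

/-- A left ideal of the free algebra is closed under transductions if it contains, with each
element without constant term, all its transductions. -/
def TransductionClosed (J : Submodule (FreeAlgebra R α) (FreeAlgebra R α)) : Prop :=
  ∀ f ∈ J, algebraMapInv f = 0 → ∀ j, transduction R j f ∈ J

theorem TransductionClosed.inf {I J : Submodule (FreeAlgebra R α) (FreeAlgebra R α)}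
    (hI : TransductionClosed I) (hJ : TransductionClosed J) : TransductionClosed (I ⊓ J) :=
  fun f hf h0 j => ⟨hI f hf.1 h0 j, hJ f hf.2 h0 j⟩

theorem TransductionClosed.transduction_sub_mem
    {J : Submodule (FreeAlgebra R α) (FreeAlgebra R α)} (hJ : TransductionClosed J)
    {p : FreeAlgebra R α} (hp : p ∈ J) (hp1 : algebraMapInv p = 1) {f : FreeAlgebra R α}
    (hf : f ∈ J) (j : α) :
    transduction R j f - algebraMapInv f • transduction R j p ∈ J := by
  rw [← map_smul, ← map_sub]
  exact hJ _ (sub_mem hf (J.smul_of_tower_mem _ hp)) (by simp [hp1]) j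

/-- The summands g and h need not have zero constant term, so each is corrected by a multiple of
`p`. The corrections cancel because ε(g) + ε(h) = 0. -/
theorem TransductionClosed.sup {I J : Submodule (FreeAlgebra R α) (FreeAlgebra R α)}
    (hI : TransductionClosed I) (hJ : TransductionClosed J) {p : FreeAlgebra R α}
    (hpI : p ∈ I) (hpJ : p ∈ J) (hp : algebraMapInv p = 1) : TransductionClosed (I ⊔ J) := by
  intro f hf h0 j
  obtain ⟨g, hg, h, hh, rfl⟩ := Submodule.mem_sup.1 hf
  refine Submodule.mem_sup.2 ⟨_, hI.transduction_sub_mem hpI hp hg j, _,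
    hJ.transduction_sub_mem hpJ hp hh j, ?_⟩
  rw [sub_add_sub_comm, ← add_smul, ← map_add, ← map_add, h0, zero_smul, sub_zero]

theorem transductionClosed_span_singleton [IsDomain R] {f : FreeAlgebra R α}
    (hf : algebraMapInv f ≠ 0) :
    TransductionClosed (Submodule.span (FreeAlgebra R α) {f}) := by
  intro g hg h0 j
  obtain ⟨u, rfl⟩ := Submodule.mem_span_singleton.1 hg
  rw [smul_eq_mul] at h0 ⊢
  have hu : algebraMapInv u = 0 := by simpa [hf] using h0
  rw [transduction_mul_of_algebraMapInv_eq_zero hu]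
  exact Submodule.mem_span_singleton.2 ⟨_, rfl⟩

/-- If a shortest nonzero f had ε(f) = 0, its transductions would be shorter elements of `J`, hence
zero, and so would f. Dividing g by f then proceeds through the transductions of ε(f)g - ε(g)f.
Powers of ε(f) appear because it need not be invertible. -/
theorem TransductionClosed.exists_minimal [Fintype α] [IsDomain R]
    {J : Submodule (FreeAlgebra R α) (FreeAlgebra R α)} (hJ : TransductionClosed J)
    {p : FreeAlgebra R α} (hp : p ∈ J) (hp0 : p ≠ 0) :
    ∃ d, (∃ f ∈ J, f ∈ lengthLT R α d ∧ f ≠ 0) ∧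
      ∀ f ∈ J, f ∈ lengthLT R α d → f ≠ 0 → algebraMapInv f ≠ 0 ∧
        ∀ g ∈ J, ∃ k : ℕ, algebraMapInv f ^ k • g ∈ Submodule.span (FreeAlgebra R α) {f} := by
  classical
  have hex : ∃ d, ∃ f ∈ J, f ∈ lengthLT R α d ∧ f ≠ 0 := by
    obtain ⟨d, hd⟩ := exists_mem_lengthLT p
    exact ⟨d, p, hp, hd, hp0⟩
  refine ⟨Nat.find hex, Nat.find_spec hex, ?_⟩
  have hmin : ∀ m < Nat.find hex, ∀ f ∈ J, f ∈ lengthLT R α m → f = 0 := by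
    intro m hm f hf hfm
    by_contra h
    exact Nat.find_min hex hm ⟨f, hf, hfm, h⟩
  obtain ⟨e, he⟩ : ∃ e, Nat.find hex = e + 1 := by
    refine Nat.exists_eq_succ_of_ne_zero fun h => ?_
    obtain ⟨f, -, hf, hf0⟩ := Nat.find_spec hex
    rw [h] at hf
    exact hf0 hf
  rw [he] at hmin ⊢
  intro f hf hfd hf0
  refine ⟨fun h => hf0 (eq_zero_of_transduction h fun j =>
    hmin e e.lt_succ_self _ (hJ f hf h j) (mem_lengthLT_succ.1 hfd j)), fun g hg => ?_⟩
  set c := algebraMapInv f with hc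
  obtain ⟨m, hm⟩ := exists_mem_lengthLT g
  induction m generalizing g with
  | zero => exact ⟨0, by simp [mem_lengthLT_zero.1 hm]⟩
  | succ m ih =>
    have hfs := Submodule.mem_span_singleton_self (R := FreeAlgebra R α) f
    set h := c • g - algebraMapInv g • f with hh
    have hhJ : h ∈ J := sub_mem (J.smul_of_tower_mem _ hg) (J.smul_of_tower_mem _ hf)
    have hh0 : algebraMapInv h = 0 := by simp [hh, ← hc, mul_comm]
    have key (j : α) : ∃ k : ℕ, c ^ k • transduction R j h ∈
        Submodule.span (FreeAlgebra R α) {f} := by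
      have hjg := mem_lengthLT_succ.1 hm j
      have hjf := mem_lengthLT_succ.1 hfd j
      have htr : transduction R j h =
          c • transduction R j g - algebraMapInv g • transduction R j f := by simp [hh]
      -- When g is no longer than f, minimality kills the transductions of `h`. Otherwise they are
      -- shorter than the bound on g, and induction applies.
      rcases le_total m e with hme | hme
      · refine ⟨0, ?_⟩
        rw [hmin e e.lt_succ_self _ (hJ h hhJ hh0 j), smul_zero]
        · exact zero_mem _
        · rw [htr]
          exact sub_mem (Submodule.smul_mem _ _ (lengthLT_mono hme hjg))
            (Submodule.smul_mem _ _ hjf)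
      · refine ih _ (hJ h hhJ hh0 j) ?_
        rw [htr]
        exact sub_mem (Submodule.smul_mem _ _ hjg)
          (Submodule.smul_mem _ _ (lengthLT_mono hme hjf))
    choose k hk using key
    -- The supremum serves all transductions at once; the extra factor turns g into c • g.
    refine ⟨Finset.univ.sup k + 1, ?_⟩
    have hcg : c • g = h + algebraMapInv g • f := by simp [hh]
    rw [pow_succ, mul_smul, hcg, smul_add]
    refine add_mem ?_ (Submodule.smul_of_tower_mem _ _ (Submodule.smul_of_tower_mem _ _ hfs))
    rw [eq_algebraMapInv_add_sum h, hh0, map_zero, zero_add, Finset.smul_sum]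
    refine sum_mem fun j _ => ?_
    rw [← mul_smul_comm, ← Nat.sub_add_cancel (Finset.le_sup (f := k) (Finset.mem_univ j)),
      pow_add, mul_smul]
    exact Submodule.smul_mem _ _ (Submodule.smul_of_tower_mem _ _ (hk j))

/-! ### Generators over a field -/

section Field

variable {K : Type*} [Field K]

/-- Over a field, a transduction closed left ideal containing a comonic element is generated by a
comonic element. -/
theorem TransductionClosed.exists_eq_span_singleton [Fintype α]
    {J : Submodule (FreeAlgebra K α) (FreeAlgebra K α)} (hJ : TransductionClosed J)
    {p : FreeAlgebra K α} (hp : p ∈ J) (hp1 : algebraMapInv p = 1) :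
    ∃ f, algebraMapInv f = 1 ∧ J = Submodule.span (FreeAlgebra K α) {f} := by
  have hp0 : p ≠ 0 := by
    rintro rfl
    simp at hp1
  obtain ⟨d, ⟨f, hf, hfd, hf0⟩, h⟩ := hJ.exists_minimal hp hp0
  have hc := (h f hf hfd hf0).1
  have hg : algebraMapInv ((algebraMapInv f)⁻¹ • f) = 1 := by simp [hc]
  have hgJ : (algebraMapInv f)⁻¹ • f ∈ J := J.smul_of_tower_mem _ hf
  refine ⟨(algebraMapInv f)⁻¹ • f, hg, le_antisymm (fun g hgm => ?_)
    ((Submodule.span_singleton_le_iff_mem _ _).2 hgJ)⟩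
  obtain ⟨k, hk⟩ := (h _ hgJ (Submodule.smul_mem _ _ hfd)
    (by rintro h0; simp [h0] at hg)).2 g hgm
  simpa [hg] using hk

/-- Left multiplication by a nonzero element cannot shorten `f`. By the Leibniz rule the
transductions of `u` inherit the hypothesis, so they vanish by induction and `u` is a scalar. -/
theorem eq_zero_of_mul_mem_lengthLT [Fintype α] {e : ℕ} {f : FreeAlgebra K α}
    (hf : f ∈ lengthLT K α (e + 1)) (hfe : f ∉ lengthLT K α e) {u : FreeAlgebra K α}
    (hu : u * f ∈ lengthLT K α e) : u = 0 := by
  obtain ⟨m, hm⟩ := exists_mem_lengthLT u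
  induction m generalizing u with
  | zero => exact hm
  | succ m ih =>
    have h (j : α) : transduction K j u = 0 := by
      refine ih ?_ (mem_lengthLT_succ.1 hm j)
      rw [← add_sub_cancel_right (transduction K j u * f), ← transduction_mul]
      exact sub_mem (mem_lengthLT_succ.1 (lengthLT_le_succ e hu) j)
        (Submodule.smul_mem _ _ (mem_lengthLT_succ.1 hf j))
    refine eq_zero_of_transduction ?_ h
    by_contra hc
    refine hfe ((Submodule.smul_mem_iff _ hc).1 ?_)
    rwa [Algebra.smul_def, show algebraMap K _ (algebraMapInv u) = u by
      conv_rhs => rw [eq_algebraMapInv_add_sum u]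
      simp [h]]

theorem exists_eq_smul_of_span_eq [Fintype α] {f g : FreeAlgebra K α}
    (h : Submodule.span (FreeAlgebra K α) {f} = Submodule.span (FreeAlgebra K α) {g})
    (hf : algebraMapInv f ≠ 0) (hg : algebraMapInv g ≠ 0) : ∃ k : K, k ≠ 0 ∧ g = k • f := by
  classical
  -- The relation is symmetric, so g may be taken no longer than f. Then g = uf forces all
  -- transductions of u to vanish.
  wlog hle : ∀ d, f ∈ lengthLT K α d → g ∈ lengthLT K α d generalizing f g
  · have hle' : ∀ d, g ∈ lengthLT K α d → f ∈ lengthLT K α d := by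
      push Not at hle
      obtain ⟨d, hfd, hgd⟩ := hle
      intro e hge
      rcases le_total d e with hde | hde
      · exact lengthLT_mono hde hfd
      · exact absurd (lengthLT_mono hde hge) hgd
    obtain ⟨k, hk, rfl⟩ := this h.symm hg hf hle'
    exact ⟨k⁻¹, inv_ne_zero hk, by rw [smul_smul, inv_mul_cancel₀ hk, one_smul]⟩
  obtain ⟨u, rfl⟩ : ∃ u : FreeAlgebra K α, u * f = g := by
    exact Submodule.mem_span_singleton.1 (h ▸ Submodule.mem_span_singleton_self g)
  have hex := exists_mem_lengthLT f
  obtain ⟨e, he⟩ : ∃ e, Nat.find hex = e + 1 := by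
    refine Nat.exists_eq_succ_of_ne_zero fun h0 => hf ?_
    have := Nat.find_spec hex
    rw [h0, mem_lengthLT_zero] at this
    rw [this, map_zero]
  have hfe : f ∈ lengthLT K α (e + 1) := he ▸ Nat.find_spec hex
  have hfe' : f ∉ lengthLT K α e := Nat.find_min hex (by omega)
  have hu (j : α) : transduction K j u = 0 := by
    refine eq_zero_of_mul_mem_lengthLT hfe hfe' ?_
    rw [← add_sub_cancel_right (transduction K j u * f), ← transduction_mul]
    exact sub_mem (mem_lengthLT_succ.1 (hle _ hfe) j)
      (Submodule.smul_mem _ _ (mem_lengthLT_succ.1 hfe j))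
  refine ⟨algebraMapInv u, left_ne_zero_of_mul (by simpa using hg), ?_⟩
  conv_lhs => rw [eq_algebraMapInv_add_sum u]
  simp [hu, Algebra.smul_def]

end Field

end FreeAlgebra

/-! ### Distributivity through a central variable t -/

namespace FreeAlgebra

open Polynomial

section LengthLT

variable {R : Type*} [CommRing R] [IsDomain R] {α : Type*} [DecidableEq α]

theorem mem_lengthLT_of_smul_mem {d : ℕ} {r : R} (hr : r ≠ 0) {f : FreeAlgebra R α}
    (h : r • f ∈ lengthLT R α d) : f ∈ lengthLT R α d := by
  induction d generalizing f with
  | zero =>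
    rw [mem_lengthLT_zero] at h ⊢
    exact (smul_eq_zero.1 h).resolve_left hr
  | succ d ih =>
    rw [mem_lengthLT_succ] at h ⊢
    exact fun j => ih (by simpa using h j)

end LengthLT

variable {K : Type*} [Field K] {α : Type*}

/-- The ring of polynomials over the free algebra as an algebra over the ring of polynomials. -/
noncomputable abbrev polynomialAlgebra (K : Type*) [Field K] (α : Type*) :
    Algebra K[X] (FreeAlgebra K α)[X] :=
  (mapRingHom (algebraMap K (FreeAlgebra K α))).toAlgebra' fun q f => by
    induction q using Polynomial.induction_on' with
    | add q r hq hr => rw [map_add, add_mul, mul_add, hq, hr]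
    | monomial m r =>
      rw [coe_mapRingHom, map_monomial]
      ext k
      simp only [← C_mul_X_pow_eq_monomial]
      rw [mul_assoc, X_pow_mul, ← mul_assoc, ← mul_assoc]
      simp [coeff_mul_X_pow', Algebra.commutes]

/-- A noncommutative polynomial with coefficients in `K[t]` as a polynomial in `t` whose
coefficients are noncommutative polynomials over `K`. -/
noncomputable def toPolynomial (K : Type*) [Field K] (α : Type*) :
    FreeAlgebra K[X] α →+* (FreeAlgebra K α)[X] :=
  letI := polynomialAlgebra K α
  (lift K[X] fun i => C (ι K i) : FreeAlgebra K[X] α →ₐ[K[X]] (FreeAlgebra K α)[X]).toRingHom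

theorem toPolynomial_algebraMap (q : K[X]) :
    toPolynomial K α (algebraMap K[X] _ q) = q.map (algebraMap K (FreeAlgebra K α)) :=
  letI := polynomialAlgebra K α
  (lift K[X] fun i => C (ι K i) : FreeAlgebra K[X] α →ₐ[K[X]] (FreeAlgebra K α)[X]).commutes q

@[simp]
theorem toPolynomial_ι (i : α) : toPolynomial K α (ι K[X] i) = C (ι K i) :=
  letI := polynomialAlgebra K α
  lift_ι_apply (R := K[X]) (fun i => (C (ι K i) : (FreeAlgebra K α)[X])) i

theorem toPolynomial_smul (q : K[X]) (f : FreeAlgebra K[X] α) :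
    toPolynomial K α (q • f) = q.map (algebraMap K (FreeAlgebra K α)) * toPolynomial K α f := by
  rw [Algebra.smul_def, map_mul, toPolynomial_algebraMap]

@[simp]
theorem toPolynomial_baseChange (f : FreeAlgebra K α) :
    toPolynomial K α (baseChange K[X] f) = C f := by
  induction f using induction_left with
  | algebraMap r =>
    rw [baseChange_algebraMap, toPolynomial_algebraMap, Polynomial.algebraMap_apply, map_C]
    rfl
  | add f g hf hg => simp [hf, hg]
  | ι_mul i f hf => simp [hf]

theorem coeff_algebraMapInv (f : FreeAlgebra K[X] α) (k : ℕ) :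
    (algebraMapInv f).coeff k = algebraMapInv ((toPolynomial K α f).coeff k) := by
  induction f using induction_left with
  | algebraMap r => simp [toPolynomial_algebraMap]
  | add f g hf hg => simp [hf, hg]
  | ι_mul i f hf => simp

theorem coeff_toPolynomial_transduction [DecidableEq α] (j : α) (f : FreeAlgebra K[X] α) (k : ℕ) :
    (toPolynomial K α (transduction K[X] j f)).coeff k =
      transduction K j ((toPolynomial K α f).coeff k) := by
  induction f using induction_left with
  | algebraMap r =>
    rw [transduction_algebraMap, toPolynomial_algebraMap, coeff_map, transduction_algebraMap,
      map_zero, coeff_zero]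
  | add f g hf hg => simp [hf, hg]
  | ι_mul i f hf =>
    rw [map_mul (toPolynomial K α), toPolynomial_ι, coeff_C_mul, transduction_ι_mul,
      transduction_ι_mul]
    split_ifs <;> simp

/-- The noncommutative polynomials over `K[t]` all of whose coefficients at powers of `t` belong
to a left ideal `A`. -/
noncomputable def polynomialIdeal (A : Submodule (FreeAlgebra K α) (FreeAlgebra K α)) :
    Submodule (FreeAlgebra K[X] α) (FreeAlgebra K[X] α) where
  carrier := {f | ∀ k, (toPolynomial K α f).coeff k ∈ A}
  add_mem' hf hg k := by simpa using add_mem (hf k) (hg k)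
  zero_mem' k := by simp
  smul_mem' g f hf k := by
    rw [smul_eq_mul, map_mul, coeff_mul]
    exact sum_mem fun x _ => A.smul_mem _ (hf x.2)

theorem baseChange_mem_polynomialIdeal {A : Submodule (FreeAlgebra K α) (FreeAlgebra K α)}
    {f : FreeAlgebra K α} (hf : f ∈ A) : baseChange K[X] f ∈ polynomialIdeal A := by
  intro k
  rw [toPolynomial_baseChange, coeff_C]
  split_ifs
  · exact hf
  · exact zero_mem _

theorem TransductionClosed.polynomialIdeal [DecidableEq α]
    {A : Submodule (FreeAlgebra K α) (FreeAlgebra K α)} (hA : TransductionClosed A) :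
    TransductionClosed (polynomialIdeal A) := by
  intro f hf h0 j k
  rw [coeff_toPolynomial_transduction]
  exact hA _ (hf k) (by rw [← coeff_algebraMapInv, h0, coeff_zero]) j

/-- The saturated left ideal over `K[t]` generated by all `a + t b` with `a ∈ A`, `b ∈ B` and
`a - b ∈ C`. -/
noncomputable def graphIdeal (A B C : Submodule (FreeAlgebra K α) (FreeAlgebra K α)) :
    Submodule (FreeAlgebra K[X] α) (FreeAlgebra K[X] α) where
  -- The factor q makes the ideal saturated over K[t]. Comparing images under `toPolynomial` avoids
  -- any appeal to its injectivity.
  carrier := {f | ∃ q : K[X], q ≠ 0 ∧ ∃ u ∈ polynomialIdeal A, ∃ v ∈ polynomialIdeal B,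
    u - v ∈ polynomialIdeal C ∧ toPolynomial K α (q • f) = toPolynomial K α (u + (X : K[X]) • v)}
  add_mem' := by
    rintro f g ⟨q, hq, u, hu, v, hv, huv, h⟩ ⟨r, hr, w, hw, y, hy, hwy, h'⟩
    refine ⟨r * q, mul_ne_zero hr hq, r • u + q • w,
      add_mem (Submodule.smul_of_tower_mem _ r hu) (Submodule.smul_of_tower_mem _ q hw),
      r • v + q • y,
      add_mem (Submodule.smul_of_tower_mem _ r hv) (Submodule.smul_of_tower_mem _ q hy), ?_, ?_⟩
    · rw [add_sub_add_comm, ← smul_sub r u v, ← smul_sub q w y]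
      exact add_mem (Submodule.smul_of_tower_mem _ r huv) (Submodule.smul_of_tower_mem _ q hwy)
    · rw [show (r * q) • (f + g) = r • (q • f) + q • (r • g) by
          rw [smul_add, mul_smul, mul_comm, mul_smul],
        show r • u + q • w + (X : K[X]) • (r • v + q • y) =
          r • (u + (X : K[X]) • v) + q • (w + (X : K[X]) • y) by
          simp only [smul_add, smul_comm (X : K[X])]
          abel,
        map_add, map_add, toPolynomial_smul r, toPolynomial_smul q (r • g), h, h',
        toPolynomial_smul r, toPolynomial_smul q]
  zero_mem' := ⟨1, one_ne_zero, 0, zero_mem _, 0, zero_mem _, by simp, by simp⟩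
  smul_mem' := by
    rintro g f ⟨q, hq, u, hu, v, hv, huv, h⟩
    refine ⟨q, hq, g * u, Submodule.smul_mem _ g hu, g * v, Submodule.smul_mem _ g hv, ?_, ?_⟩
    · rw [← mul_sub]
      exact Submodule.smul_mem _ g huv
    · rw [smul_eq_mul, ← mul_smul_comm, ← mul_smul_comm, ← mul_add, map_mul, h, map_mul]

section GraphIdeal

variable {A B C : Submodule (FreeAlgebra K α) (FreeAlgebra K α)}

theorem mem_graphIdeal_of_smul_mem {r : K[X]} (hr : r ≠ 0) {f : FreeAlgebra K[X] α}
    (h : r • f ∈ graphIdeal A B C) : f ∈ graphIdeal A B C := by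
  obtain ⟨q, hq, u, hu, v, hv, huv, h⟩ := h
  exact ⟨q * r, mul_ne_zero hq hr, u, hu, v, hv, huv, by rw [mul_smul, h]⟩

theorem mem_graphIdeal_of_toPolynomial_eq {f g : FreeAlgebra K[X] α}
    (h : toPolynomial K α f = toPolynomial K α g) (hf : f ∈ graphIdeal A B C) :
    g ∈ graphIdeal A B C := by
  obtain ⟨q, hq, u, hu, v, hv, huv, hq'⟩ := hf
  exact ⟨q, hq, u, hu, v, hv, huv, by rw [toPolynomial_smul, ← h, ← toPolynomial_smul, hq']⟩

/-- Correct u and v separately by ε(u)∂ⱼp and ε(v)∂ⱼp. The total correction is (ε(u) + tε(v))∂ⱼp =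
0. -/
theorem transductionClosed_graphIdeal [DecidableEq α] (hA : TransductionClosed A)
    (hB : TransductionClosed B) (hC : TransductionClosed C) {p : FreeAlgebra K α} (hpA : p ∈ A)
    (hpB : p ∈ B) (hpC : p ∈ C) (hp : algebraMapInv p = 1) :
    TransductionClosed (graphIdeal A B C) := by
  rintro f ⟨q, hq, u, hu, v, hv, huv, h⟩ h0 j
  have hp' : algebraMapInv (baseChange K[X] p) = 1 := by simp [algebraMapInv_baseChange, hp]
  have key : algebraMapInv (u + (X : K[X]) • v) = 0 := by
    ext k
    rw [coeff_algebraMapInv, ← h, ← coeff_algebraMapInv, map_smul, h0, smul_zero]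
  refine ⟨q, hq,
    _, hA.polynomialIdeal.transduction_sub_mem (baseChange_mem_polynomialIdeal hpA) hp' hu j,
    _, hB.polynomialIdeal.transduction_sub_mem (baseChange_mem_polynomialIdeal hpB) hp' hv j,
    ?_, ?_⟩
  · have := hC.polynomialIdeal.transduction_sub_mem (baseChange_mem_polynomialIdeal hpC) hp' huv j
    rw [map_sub, map_sub, sub_smul] at this
    rwa [sub_sub_sub_comm]
  · rw [smul_sub, sub_add_sub_comm, smul_smul, ← smul_eq_mul X, ← map_smul algebraMapInv,
      ← add_smul, ← map_add, key, zero_smul, sub_zero, ← map_smul, ← map_smul, ← map_add]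
    ext1 k
    rw [coeff_toPolynomial_transduction, coeff_toPolynomial_transduction, h]

/-- Coefficients of qb = u + tv give qₖb = uₖ + vₖ₋₁, so uₖ ∈ A ∩ B. Moreover vₖ = uₖ - (uₖ - vₖ),
where uₖ - vₖ ∈ B ∩ C. -/
theorem mem_sup_of_baseChange_mem_graphIdeal {b : FreeAlgebra K α} (hb : b ∈ B)
    (h : baseChange K[X] b ∈ graphIdeal A B C) : b ∈ (A ⊓ B) ⊔ (B ⊓ C) := by
  obtain ⟨q, hq, u, hu, v, hv, huv, h⟩ := h
  have hcoeff (k : ℕ) : q.coeff k • b =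
      (toPolynomial K α u).coeff k + (X * toPolynomial K α v).coeff k := by
    rw [toPolynomial_smul, map_add, toPolynomial_smul, toPolynomial_baseChange, map_X] at h
    rw [← coeff_add, ← h, coeff_mul_C, coeff_map, Algebra.smul_def]
  have hv' (k : ℕ) (hk : (toPolynomial K α u).coeff k ∈ B) :
      (toPolynomial K α v).coeff k ∈ (A ⊓ B) ⊔ (B ⊓ C) := by
    rw [← sub_sub_cancel ((toPolynomial K α u).coeff k) ((toPolynomial K α v).coeff k)]
    refine sub_mem (Submodule.mem_sup_left ⟨hu k, hk⟩)
      (Submodule.mem_sup_right ⟨sub_mem hk (hv k), ?_⟩)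
    simpa using huv k
  have huB (k : ℕ) : (toPolynomial K α u).coeff k ∈ B := by
    rw [← add_sub_cancel_right ((toPolynomial K α u).coeff k)
      ((X * toPolynomial K α v).coeff k), ← hcoeff k]
    refine sub_mem (B.smul_of_tower_mem _ hb) ?_
    cases k with
    | zero => simp
    | succ k => simpa using hv k
  obtain ⟨k, hk⟩ : ∃ k, q.coeff k ≠ 0 := by
    by_contra! h
    exact hq (Polynomial.ext h)
  rw [← inv_smul_smul₀ hk b, hcoeff k]
  refine Submodule.smul_of_tower_mem _ _ (add_mem (Submodule.mem_sup_left ⟨hu k, huB k⟩) ?_)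
  cases k with
  | zero => simp
  | succ k => simpa using hv' k (huB k)

/-- Among shortest elements δ, pick one with qp = γδ and deg q minimal. A prime factor of q would
divide γ or δ and could be cancelled, so q is a unit, and therefore so is ε(δ). -/
theorem exists_unimodular_generator [Fintype α] [DecidableEq α] (hA : TransductionClosed A)
    (hB : TransductionClosed B) (hC : TransductionClosed C) {p : FreeAlgebra K α} (hpA : p ∈ A)
    (hpB : p ∈ B) (hpC : p ∈ C) (hp : algebraMapInv p = 1) :
    ∃ δ ∈ graphIdeal A B C, (∃ e, toPolynomial K α δ = Polynomial.C e) ∧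
      ∀ f ∈ graphIdeal A B C, ∃ h, f = h * δ := by
  classical
  set p' := baseChange K[X] p with hp'
  have hp1 : algebraMapInv p' = 1 := by simp [hp', algebraMapInv_baseChange, hp]
  have hp0 : p' ≠ 0 := by
    rintro h
    simp [h] at hp1
  have hpG : p' ∈ graphIdeal A B C :=
    ⟨1, one_ne_zero, p', baseChange_mem_polynomialIdeal hpA, 0, zero_mem _,
      by simpa using baseChange_mem_polynomialIdeal hpC, by simp⟩
  obtain ⟨d, ⟨f₀, hf₀, hf₀d, hf₀0⟩, hmin⟩ :=
    (transductionClosed_graphIdeal hA hB hC hpA hpB hpC hp).exists_minimal hpG hp0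
  have hex : ∃ m, ∃ q : K[X], q ≠ 0 ∧ q.natDegree = m ∧ ∃ δ ∈ graphIdeal A B C,
      δ ∈ lengthLT K[X] α d ∧ δ ≠ 0 ∧ ∃ γ, q • p' = γ * δ := by
    obtain ⟨hc, h⟩ := hmin f₀ hf₀ hf₀d hf₀0
    obtain ⟨k, hk⟩ := h p' hpG
    obtain ⟨γ, hγ⟩ := Submodule.mem_span_singleton.1 hk
    exact ⟨_, _, pow_ne_zero k hc, rfl, f₀, hf₀, hf₀d, hf₀0, γ, hγ.symm⟩
  obtain ⟨q, hq0, hqm, δ, hδ, hδd, hδ0, γ, hγ⟩ := Nat.find_spec hex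
  have hqu : IsUnit q := by
    by_contra hqu
    obtain ⟨a, ha, q', rfl⟩ := WfDvdMonoid.exists_irreducible_factor hqu hq0
    have ha0 := ha.ne_zero
    have hq'0 : q' ≠ 0 := right_ne_zero_of_mul hq0
    have hdeg : q'.natDegree < Nat.find hex := by
      have := ha.natDegree_pos
      rw [natDegree_mul ha0 hq'0] at hqm
      omega
    rw [mul_smul] at hγ
    rcases exists_eq_smul_or_of_prime ha.prime hγ.symm with ⟨γ', rfl⟩ | ⟨δ', rfl⟩
    · rw [smul_mul_assoc] at hγ
      exact Nat.find_min hex hdeg ⟨q', hq'0, rfl, δ, hδ, hδd, hδ0, γ',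
        smul_right_injective _ ha0 hγ⟩
    · rw [mul_smul_comm] at hγ
      exact Nat.find_min hex hdeg ⟨q', hq'0, rfl, δ', mem_graphIdeal_of_smul_mem ha0 hδ,
        mem_lengthLT_of_smul_mem ha0 hδd, right_ne_zero_of_smul hδ0, γ,
        smul_right_injective _ ha0 hγ⟩
  have hδu : IsUnit (algebraMapInv δ) := by
    have := congrArg algebraMapInv hγ
    rw [map_smul, hp1, smul_eq_mul, mul_one, map_mul] at this
    exact isUnit_of_mul_isUnit_right (this ▸ hqu)
  refine ⟨δ, hδ, ?_, fun f hf => ?_⟩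
  -- The product γδ is a nonzero constant in t, and degrees in t add over a domain.
  · obtain ⟨r, hr, rfl⟩ := Polynomial.isUnit_iff.1 hqu
    have h := congrArg (toPolynomial K α) hγ
    rw [toPolynomial_smul, hp', toPolynomial_baseChange, map_C, ← C_mul,
      map_mul (toPolynomial K α)] at h
    have h0 : Polynomial.C (algebraMap K (FreeAlgebra K α) r * p) ≠ 0 := by
      rw [Ne, C_eq_zero, mul_eq_zero, not_or]
      refine ⟨by simpa using hr.ne_zero, ?_⟩
      rintro rfl
      simp at hp
    have hd := congrArg natDegree h
    rw [h] at h0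
    rw [natDegree_C, natDegree_mul (left_ne_zero_of_mul h0) (right_ne_zero_of_mul h0)] at hd
    exact ⟨_, eq_C_of_natDegree_eq_zero (by omega)⟩
  · obtain ⟨k, hk⟩ := (hmin δ hδ hδd hδ0).2 f hf
    obtain ⟨c, hc⟩ := (hδu.pow k).exists_left_inv
    obtain ⟨h, hh⟩ := Submodule.mem_span_singleton.1 hk
    refine ⟨c • h, ?_⟩
    rw [smul_mul_assoc, ← smul_eq_mul h, hh, smul_smul, hc, one_smul]

/-- Transduction closed left ideals containing a comonic element satisfy the distributive law. -/
theorem TransductionClosed.inf_sup_le [Fintype α] [DecidableEq α] (hA : TransductionClosed A)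
    (hB : TransductionClosed B) (hC : TransductionClosed C) {p : FreeAlgebra K α} (hpA : p ∈ A)
    (hpB : p ∈ B) (hpC : p ∈ C) (hp : algebraMapInv p = 1) :
    A ⊓ (B ⊔ C) ≤ (A ⊓ B) ⊔ (A ⊓ C) := by
  rintro a ⟨ha, habc⟩
  obtain ⟨b, hb, c, hc, rfl⟩ := Submodule.mem_sup.1 habc
  obtain ⟨δ, hδ, ⟨e, he⟩, hgen⟩ := exists_unimodular_generator hA hB hC hpA hpB hpC hp
  have hmem : baseChange K[X] (b + c) + (X : K[X]) • baseChange K[X] b ∈ graphIdeal A B C := by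
    refine ⟨1, one_ne_zero, _, baseChange_mem_polynomialIdeal ha, _,
      baseChange_mem_polynomialIdeal hb, ?_, by rw [one_smul]⟩
    rw [← map_sub, add_sub_cancel_left]
    exact baseChange_mem_polynomialIdeal hc
  obtain ⟨h, hh⟩ := hgen _ hmem
  have hb' : b = (toPolynomial K α h).coeff 1 * e := by
    have := congrArg (fun f => (toPolynomial K α f).coeff 1) hh
    simpa [toPolynomial_smul, he, coeff_C] using this
  have hbG : baseChange K[X] b ∈ graphIdeal A B C := by
    refine mem_graphIdeal_of_toPolynomial_eq ?_
      (Submodule.smul_mem _ (baseChange K[X] ((toPolynomial K α h).coeff 1)) hδ)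
    rw [smul_eq_mul, map_mul, toPolynomial_baseChange, toPolynomial_baseChange, he, ← C_mul, ← hb']
  obtain ⟨x, hx, y, hy, rfl⟩ :=
    Submodule.mem_sup.1 (mem_sup_of_baseChange_mem_graphIdeal hb hbG)
  rw [add_assoc] at ha ⊢
  -- Here b = x + y, and y + c = a - x lies in both A and C.
  refine Submodule.mem_sup.2 ⟨x, hx, y + c, ⟨?_, add_mem hy.2 hc⟩, rfl⟩
  simpa using sub_mem ha hx.1

end GraphIdeal

end FreeAlgebra

/-! ### Contraction and extension between Λ and 𝕃 -/

namespace LeavittAlgebra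

open FreeAlgebra

variable {K : Type*} [Field K] {n : ℕ}

/-- The quotient map from the free algebra on all generators onto the Leavitt algebra. -/
noncomputable def mk (K : Type*) [Field K] (n : ℕ) :
    FreeAlgebra K (Fin n ⊕ Fin n) →ₐ[K] LeavittAlgebra K n :=
  RingQuot.mkAlgHom K (LeavittRel K n)

theorem mk_surjective : Function.Surjective (mk K n) :=
  RingQuot.mkAlgHom_surjective K (LeavittRel K n)

@[simp]
theorem mk_inl (i : Fin n) : mk K n (ι K (Sum.inl i)) = x K i := rfl

@[simp]
theorem mk_inr (i : Fin n) : mk K n (ι K (Sum.inr i)) = xStar K i := rfl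

theorem xStar_mul_x (i j : Fin n) : xStar K j * x K i = if j = i then 1 else 0 := by
  have h : mk K n _ = mk K n _ := RingQuot.mkAlgHom_rel K (LeavittRel.star_mul (K := K) i j)
  rw [map_mul, mk_inl, mk_inr] at h
  rw [h]
  split_ifs <;> simp

@[simp]
theorem ofFree_ι (i : Fin n) : ofFree K n (ι K i) = x K i := by
  simp [ofFree]

theorem xStar_mul_ofFree (j : Fin n) (f : FreeAlgebra K (Fin n)) :
    xStar K j * ofFree K n f =
      algebraMapInv f • xStar K j + ofFree K n (transduction K j f) := by
  conv_lhs => rw [eq_algebraMapInv_add_sum f]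
  rw [map_add, mul_add, AlgHom.commutes, ← Algebra.commutes, ← Algebra.smul_def, map_sum,
    Finset.mul_sum]
  simp [← mul_assoc, xStar_mul_x]

theorem exists_lift {B : Type*} [Ring B] [Algebra K B] (a b : Fin n → B)
    (hab : ∑ i, a i * b i = 1) (hba : ∀ i j, b j * a i = if j = i then 1 else 0) :
    ∃ φ : LeavittAlgebra K n →ₐ[K] B,
    (∀ i, φ (x K i) = a i) ∧ ∀ i, φ (xStar K i) = b i := by
  have h : ∀ ⦃u v⦄, LeavittRel K n u v →
      FreeAlgebra.lift K (Sum.elim a b) u = FreeAlgebra.lift K (Sum.elim a b) v := by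
    rintro _ _ (_ | ⟨i, j⟩)
    · simpa using hab
    · rw [map_mul, lift_ι_apply, lift_ι_apply, Sum.elim_inl, Sum.elim_inr, hba]
      split_ifs <;> simp
  let φ : RingQuot (LeavittRel K n) →ₐ[K] B := RingQuot.liftAlgHom K ⟨_, h⟩
  refine ⟨φ, fun i => ?_, fun i => ?_⟩
  · exact (RingQuot.liftAlgHom_mkAlgHom_apply K _ h _).trans (by simp)
  · exact (RingQuot.liftAlgHom_mkAlgHom_apply K _ h _).trans (by simp)

/-- The elements of the free algebra that belong to a left ideal of the Leavitt algebra. -/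
noncomputable def contraction (I : Submodule (LeavittAlgebra K n) (LeavittAlgebra K n)) :
    Submodule (FreeAlgebra K (Fin n)) (FreeAlgebra K (Fin n)) where
  carrier := {f | ofFree K n f ∈ I}
  add_mem' hf hg := by simpa using add_mem hf hg
  zero_mem' := by simp
  smul_mem' g f hf := by simpa using I.smul_mem (ofFree K n g) hf

theorem mem_contraction {I : Submodule (LeavittAlgebra K n) (LeavittAlgebra K n)}
    {f : FreeAlgebra K (Fin n)} : f ∈ contraction I ↔ ofFree K n f ∈ I := Iff.rfl

theorem transductionClosed_contraction
    (I : Submodule (LeavittAlgebra K n) (LeavittAlgebra K n)) :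
    TransductionClosed (contraction I) := by
  intro f hf h0 j
  have := I.smul_mem (xStar K j) hf
  rwa [smul_eq_mul, xStar_mul_ofFree, h0, zero_smul, zero_add] at this

/-- The left ideal of the Leavitt algebra generated by a left ideal of the free algebra. -/
noncomputable def extension (J : Submodule (FreeAlgebra K (Fin n)) (FreeAlgebra K (Fin n))) :
    Submodule (LeavittAlgebra K n) (LeavittAlgebra K n) :=
  Submodule.span _ (ofFree K n '' J)

theorem extension_mono {I J : Submodule (FreeAlgebra K (Fin n)) (FreeAlgebra K (Fin n))}
    (h : I ≤ J) : extension I ≤ extension J :=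
  Submodule.span_mono (Set.image_mono h)

theorem ofFree_mem_extension {J : Submodule (FreeAlgebra K (Fin n)) (FreeAlgebra K (Fin n))}
    {f : FreeAlgebra K (Fin n)} (hf : f ∈ J) : ofFree K n f ∈ extension J :=
  Submodule.subset_span ⟨f, hf, rfl⟩

theorem contraction_mono {I J : Submodule (LeavittAlgebra K n) (LeavittAlgebra K n)}
    (h : I ≤ J) : contraction I ≤ contraction J :=
  fun _ hf => h hf

theorem extension_span_singleton (d : FreeAlgebra K (Fin n)) :
    extension (Submodule.span (FreeAlgebra K (Fin n)) {d}) = leftIdeal d := by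
  refine le_antisymm (Submodule.span_le.2 ?_) (Submodule.span_mono ?_)
  · rintro _ ⟨f, hf, rfl⟩
    obtain ⟨g, rfl⟩ := Submodule.mem_span_singleton.1 hf
    exact Submodule.mem_span_singleton.2 ⟨ofFree K n g, by simp⟩
  · rintro _ rfl
    exact ⟨d, Submodule.mem_span_singleton_self d, rfl⟩

/-- Since xⱼ* p = xⱼ* + ∂ⱼp lies in `I`, each xⱼ* f is congruent to ∂ⱼf - ε(f)∂ⱼp modulo `I`. -/
theorem exists_sub_ofFree_mem {I : Submodule (LeavittAlgebra K n) (LeavittAlgebra K n)}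
    {p : FreeAlgebra K (Fin n)} (hpI : ofFree K n p ∈ I) (hp : algebraMapInv p = 1)
    (u : LeavittAlgebra K n) : ∃ f, u - ofFree K n f ∈ I := by
  obtain ⟨g, rfl⟩ := mk_surjective u
  induction g using induction_left with
  | algebraMap r => exact ⟨algebraMap K _ r, by simp⟩
  | add g h hg hh =>
    obtain ⟨f, hf⟩ := hg
    obtain ⟨e, he⟩ := hh
    exact ⟨f + e, by simpa only [map_add, add_sub_add_comm] using add_mem hf he⟩
  | ι_mul i g hg =>
    obtain ⟨f, hf⟩ := hg
    rcases i with i | j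
    · refine ⟨ι K i * f, ?_⟩
      simpa [mul_sub] using I.smul_mem (x K i) hf
    · refine ⟨transduction K j f - algebraMapInv f • transduction K j p, ?_⟩
      have h1 := I.smul_mem (xStar K j) hf
      have h2 := I.smul_of_tower_mem (algebraMapInv f) (I.smul_mem (xStar K j) hpI)
      rw [smul_eq_mul, mul_sub, xStar_mul_ofFree] at h1
      rw [smul_eq_mul, xStar_mul_ofFree, hp, one_smul, smul_add] at h2
      have h3 := add_mem h1 h2
      rw [map_mul, mk_inr, map_sub, map_smul]
      convert h3 using 1
      abel

theorem extension_contraction {I : Submodule (LeavittAlgebra K n) (LeavittAlgebra K n)}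
    {p : FreeAlgebra K (Fin n)} (hpI : ofFree K n p ∈ I) (hp : algebraMapInv p = 1) :
    extension (contraction I) = I := by
  have hle : extension (contraction I) ≤ I := by
    refine Submodule.span_le.2 ?_
    rintro _ ⟨f, hf, rfl⟩
    exact hf
  refine le_antisymm hle fun u hu => ?_
  obtain ⟨f, hf⟩ := exists_sub_ofFree_mem (ofFree_mem_extension (J := contraction I) hpI) hp u
  have hfI : ofFree K n f ∈ I := by simpa using sub_mem hu (hle hf)
  simpa using add_mem hf (ofFree_mem_extension (J := contraction I) hfI)

/-- For a comonic `d`, the Leavitt algebra acts on the quotient of the free algebra by the left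
ideal generated by `d`, extending the action of the free algebra. -/
theorem exists_representation {d : FreeAlgebra K (Fin n)} (hd : algebraMapInv d = 1) :
    ∃ φ : LeavittAlgebra K n →ₐ[K] Module.End K (FreeAlgebra K (Fin n) ⧸
        (Submodule.span (FreeAlgebra K (Fin n)) {d}).restrictScalars K),
      ∀ f g, φ (ofFree K n f) (Submodule.Quotient.mk g) = Submodule.Quotient.mk (f * g) := by
  set S := (Submodule.span (FreeAlgebra K (Fin n)) {d}).restrictScalars K with hS
  have hmem (f) : f ∈ S ↔ ∃ u, u * d = f := Submodule.mem_span_singleton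
  have hX (i : Fin n) : S ≤ S.comap (LinearMap.mulLeft K (ι K i)) := by
    intro f hf
    exact Submodule.smul_mem (Submodule.span (FreeAlgebra K (Fin n)) {d}) (ι K i) hf
  -- The action of xⱼ* is forced: xⱼ* f = ε(f)xⱼ* + ∂ⱼf, and xⱼ* must act on the class of 1 as -∂ⱼd.
  let D (j : Fin n) : FreeAlgebra K (Fin n) →ₗ[K] FreeAlgebra K (Fin n) :=
    transduction K j - (algebraMapInv.toLinearMap).smulRight (transduction K j d)
  have hD (j) (f) : D j f = transduction K j f - algebraMapInv f • transduction K j d := rfl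
  have hDS (j : Fin n) : S ≤ S.comap (D j) := by
    intro f hf
    obtain ⟨u, rfl⟩ := (hmem f).1 hf
    refine (hmem _).2 ⟨transduction K j u, ?_⟩
    rw [hD, transduction_mul, map_mul, hd, mul_one, add_sub_cancel_right]
  -- Before passing to the quotient, the sum is f - ε(f)d.
  have hsum (f) : S.mkQ (∑ i, ι K i * D i f) = S.mkQ f := by
    refine (Submodule.Quotient.eq S).2 ((hmem _).2 ⟨-algebraMap K _ (algebraMapInv f), ?_⟩)
    have hf := eq_algebraMapInv_add_sum f
    have hd' := eq_algebraMapInv_add_sum d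
    rw [hd, map_one] at hd'
    simp only [hD, mul_sub, Finset.sum_sub_distrib, mul_smul_comm, ← Finset.smul_sum]
    rw [eq_sub_of_add_eq' hf.symm, eq_sub_of_add_eq' hd'.symm, Algebra.smul_def, mul_sub]
    noncomm_ring
  obtain ⟨φ, hφ, -⟩ := exists_lift (K := K) (fun i => S.mapQ S _ (hX i))
    (fun i => S.mapQ S _ (hDS i)) (by
      ext f
      simp only [LinearMap.sum_apply, Module.End.mul_apply, LinearMap.comp_apply,
        Submodule.mkQ_apply, Submodule.mapQ_apply, LinearMap.mulLeft_apply, Module.End.one_apply]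
      exact (map_sum S.mkQ _ _).symm.trans (hsum f)) (by
      intro i j
      ext f
      simp only [Module.End.mul_apply, LinearMap.comp_apply,
        Submodule.mkQ_apply, Submodule.mapQ_apply, LinearMap.mulLeft_apply, hD,
        transduction_ι_mul, map_mul, algebraMapInv_ι, zero_mul, zero_smul, sub_zero,
        eq_comm (a := i)]
      split_ifs <;> simp)
  refine ⟨φ, fun f => ?_⟩
  induction f using induction_left with
  | algebraMap r =>
    intro g
    rw [AlgHom.commutes, AlgHom.commutes, ← Algebra.smul_def, Module.algebraMap_end_apply,
      Submodule.Quotient.mk_smul]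
  | add f h hf hh =>
    intro g
    rw [map_add, map_add, LinearMap.add_apply, hf, hh, add_mul, Submodule.Quotient.mk_add]
  | ι_mul i f hf =>
    intro g
    rw [map_mul, map_mul, Module.End.mul_apply, hf, ofFree_ι, hφ, Submodule.mapQ_apply,
      LinearMap.mulLeft_apply, mul_assoc]

/-- In the representation on Λ/Λd the element d kills the class of 1. Hence so does every f ∈ 𝕃d,
which means f ∈ Λd. -/
theorem contraction_leftIdeal_of_comonic {d : FreeAlgebra K (Fin n)} (hd : algebraMapInv d = 1) :
    contraction (leftIdeal d) = Submodule.span (FreeAlgebra K (Fin n)) {d} := by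
  refine le_antisymm (fun f hf => ?_) ((Submodule.span_singleton_le_iff_mem _ _).2
    (Submodule.mem_span_singleton_self (ofFree K n d)))
  obtain ⟨u, hu⟩ := Submodule.mem_span_singleton.1 (mem_contraction.1 hf)
  obtain ⟨φ, hφ⟩ := exists_representation hd
  have h := hφ f 1
  have hd0 := hφ d 1
  rw [mul_one] at h hd0
  replace hd0 := hd0.trans ((Submodule.Quotient.mk_eq_zero _).2
    (Submodule.mem_span_singleton_self (R := FreeAlgebra K (Fin n)) d))
  rw [← hu, smul_eq_mul, map_mul, Module.End.mul_apply, hd0, map_zero] at h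
  exact (Submodule.Quotient.mk_eq_zero _).1 h.symm

theorem span_singleton_smul {k : K} (hk : k ≠ 0) (d : FreeAlgebra K (Fin n)) :
    Submodule.span (FreeAlgebra K (Fin n)) {k • d} = Submodule.span (FreeAlgebra K (Fin n)) {d} := by
  rw [← one_mul d, ← smul_mul_assoc, ← Algebra.algebraMap_eq_smul_one, one_mul, ← smul_eq_mul]
  exact Submodule.span_singleton_smul_eq (hk.isUnit.map _) d

theorem leftIdeal_smul {k : K} (hk : k ≠ 0) (d : FreeAlgebra K (Fin n)) :
    leftIdeal (k • d) = leftIdeal d := by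
  rw [← extension_span_singleton, span_singleton_smul hk, extension_span_singleton]

theorem contraction_leftIdeal {d : FreeAlgebra K (Fin n)} (hd : algebraMapInv d ≠ 0) :
    contraction (leftIdeal d) = Submodule.span (FreeAlgebra K (Fin n)) {d} := by
  rw [← leftIdeal_smul (inv_ne_zero hd), ← span_singleton_smul (inv_ne_zero hd) d]
  exact contraction_leftIdeal_of_comonic (by simp [hd])

end LeavittAlgebra

/-! ### The lattice of right factors -/

section FactorLattice

open FreeAlgebra LeavittAlgebra

variable {K : Type*} [Field K] {n : ℕ} {p : FreeAlgebra K (Fin n)}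

theorem IsComonic.algebraMapInv_ne_zero (hp : IsComonic p) {c d : FreeAlgebra K (Fin n)}
    (h : p = c * d) : algebraMapInv d ≠ 0 := by
  intro h0
  have : algebraMapInv p = 1 := hp
  simp [h, h0] at this

/-- A generator is a right factor of `p`, so its constant term is nonzero and its multiples are
transduction closed. The converse is the division algorithm. -/
theorem IsComonic.isPrincipal_iff (hp : IsComonic p)
    {I : Submodule (FreeAlgebra K (Fin n)) (FreeAlgebra K (Fin n))} (hpI : p ∈ I) :
    I.IsPrincipal ↔ TransductionClosed I := by
  refine ⟨fun h => ?_, fun h => ?_⟩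
  · obtain ⟨d, rfl⟩ := h.principal
    obtain ⟨c, hc⟩ := Submodule.mem_span_singleton.1 hpI
    exact transductionClosed_span_singleton (hp.algebraMapInv_ne_zero hc.symm)
  · obtain ⟨d, -, hd⟩ := h.exists_eq_span_singleton hpI hp
    exact ⟨d, hd⟩

/-- The lattice of principal left ideals of the free algebra containing a comonic element. -/
noncomputable def IsComonic.factorLattice (hp : IsComonic p) :
    Sublattice (Submodule (FreeAlgebra K (Fin n)) (FreeAlgebra K (Fin n))) where
  carrier := {I | I.IsPrincipal ∧ p ∈ I}
  supClosed' I hI J hJ := by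
    have hIJ : p ∈ I ⊔ J := Submodule.mem_sup_left hI.2
    exact ⟨(hp.isPrincipal_iff hIJ).2 (((hp.isPrincipal_iff hI.2).1 hI.1).sup
      ((hp.isPrincipal_iff hJ.2).1 hJ.1) hI.2 hJ.2 hp), hIJ⟩
  infClosed' I hI J hJ := by
    have hIJ : p ∈ I ⊓ J := ⟨hI.2, hJ.2⟩
    exact ⟨(hp.isPrincipal_iff hIJ).2 (((hp.isPrincipal_iff hI.2).1 hI.1).inf
      ((hp.isPrincipal_iff hJ.2).1 hJ.1)), hIJ⟩

theorem IsComonic.mem_factorLattice (hp : IsComonic p)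
    {I : Submodule (FreeAlgebra K (Fin n)) (FreeAlgebra K (Fin n))} :
    I ∈ hp.factorLattice ↔ I.IsPrincipal ∧ p ∈ I := Iff.rfl

theorem IsComonic.inf_sup_eq (hp : IsComonic p) (I J M : hp.factorLattice) :
    I ⊓ (J ⊔ M) = (I ⊓ J) ⊔ (I ⊓ M) := by
  refine le_antisymm ?_ le_inf_sup
  exact TransductionClosed.inf_sup_le ((hp.isPrincipal_iff I.2.2).1 I.2.1)
    ((hp.isPrincipal_iff J.2.2).1 J.2.1) ((hp.isPrincipal_iff M.2.2).1 M.2.1)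
    I.2.2 J.2.2 M.2.2 hp

/-- Contraction identifies the left ideals of the Leavitt algebra above the one generated by a
comonic element with the principal left ideals of the free algebra containing that element. -/
noncomputable def IsComonic.contractionIso (hp : IsComonic p) :
    Set.Ici (leftIdeal p) ≃o hp.factorLattice where
  toFun I :=
    have hpI : p ∈ contraction I.1 := I.2 (Submodule.mem_span_singleton_self _)
    ⟨contraction I.1, (hp.isPrincipal_iff hpI).2 (transductionClosed_contraction I.1), hpI⟩
  invFun J := ⟨extension J.1,
    (Submodule.span_singleton_le_iff_mem _ _).2 (ofFree_mem_extension J.2.2)⟩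
  left_inv I := Subtype.ext
    (extension_contraction (p := p) (I.2 (Submodule.mem_span_singleton_self _)) hp)
  right_inv J := Subtype.ext <| by
    obtain ⟨J, hJ, hpJ⟩ := J
    obtain ⟨d, rfl⟩ := hJ.principal
    obtain ⟨c, hc⟩ := Submodule.mem_span_singleton.1 hpJ
    change contraction (extension _) = _
    rw [extension_span_singleton, contraction_leftIdeal (hp.algebraMapInv_ne_zero hc.symm)]
  map_rel_iff' {I J} := by
    refine ⟨fun h => ?_, fun h => contraction_mono h⟩
    have h' : extension (contraction I.1) ≤ extension (contraction J.1) := extension_mono h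
    rwa [extension_contraction (p := p) (I.2 (Submodule.mem_span_singleton_self _)) hp,
      extension_contraction (p := p) (J.2 (Submodule.mem_span_singleton_self _)) hp] at h'

theorem RightFactor.ofFree_mem (d : RightFactor p) : ofFree K n p ∈ leftIdeal d.1 := by
  obtain ⟨c, hc⟩ := d.2
  exact Submodule.mem_span_singleton.2 ⟨ofFree K n c, by rw [smul_eq_mul, ← map_mul, ← hc]⟩

theorem RightFactor.leftIdeal_le (d : RightFactor p) : leftIdeal p ≤ leftIdeal d.1 :=
  (Submodule.span_singleton_le_iff_mem _ _).2 d.ofFree_mem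

/-- The left ideal of the Leavitt algebra attached to a class of right factors. -/
noncomputable def RightFactorClass.leftIdeal (c : RightFactorClass p) :
    {I : Submodule (LeavittAlgebra K n) (LeavittAlgebra K n) // ofFree K n p ∈ I} :=
  Quotient.lift (s := rightFactorSetoid p)
    (fun d : RightFactor p => ⟨LeavittAlgebra.leftIdeal d.1, d.ofFree_mem⟩)
    (by
      rintro d e ⟨k, hk, h⟩
      exact Subtype.ext ((leftIdeal_smul hk _).symm.trans (congrArg _ h.symm))) c

theorem RightFactorClass.leftIdeal_bijective (hp : IsComonic p) :
    Function.Bijective (RightFactorClass.leftIdeal (p := p)) := by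
  refine ⟨?_, fun I => ?_⟩
  · rintro ⟨d⟩ ⟨e⟩ h
    have h' : LeavittAlgebra.leftIdeal d.1 = LeavittAlgebra.leftIdeal e.1 :=
      congrArg Subtype.val h
    obtain ⟨c, hc⟩ := d.2
    obtain ⟨b, hb⟩ := e.2
    have hd := hp.algebraMapInv_ne_zero hc
    have he := hp.algebraMapInv_ne_zero hb
    refine Quotient.sound (s := rightFactorSetoid p) (exists_eq_smul_of_span_eq ?_ hd he)
    rw [← contraction_leftIdeal hd, h', contraction_leftIdeal he]
  · obtain ⟨I, hI⟩ := I
    obtain ⟨d, -, hd⟩ := (transductionClosed_contraction I).exists_eq_span_singleton hI hp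
    have hpd : p ∈ contraction I := hI
    rw [hd] at hpd
    obtain ⟨c, hc⟩ := Submodule.mem_span_singleton.1 hpd
    refine ⟨RightFactor.toClass ⟨d, c, hc.symm⟩, Subtype.ext ?_⟩
    change LeavittAlgebra.leftIdeal d = I
    rw [← extension_span_singleton, ← hd, extension_contraction hI hp]

end FactorLattice

theorem corollary4p11 {K : Type*} [Field K] (n : ℕ) (hn : 2 ≤ n)
    (p : FreeAlgebra K (Fin n)) (hp : IsComonic p) :
    -- `d ↦ 𝕃d` is a bijection from right factors up to scalars to left ideals containing `p`
    (∃ φ : RightFactorClass p ≃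
        {I : Submodule (LeavittAlgebra K n) (LeavittAlgebra K n) //
          LeavittAlgebra.ofFree K n p ∈ I},
      ∀ d : RightFactor p, (φ d.toClass).1 = LeavittAlgebra.leftIdeal d.1) ∧
    -- principal left ideals of `Λ` containing `p` form a distributive sublattice `P` of the
    -- lattice of left ideals, isomorphic to the submodule lattice of `𝕃/𝕃p`
    (∃ P : Sublattice (Submodule (FreeAlgebra K (Fin n)) (FreeAlgebra K (Fin n))),
      (∀ I : Submodule (FreeAlgebra K (Fin n)) (FreeAlgebra K (Fin n)),
        I ∈ P ↔ I.IsPrincipal ∧ p ∈ I) ∧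
      (∀ I J M : P, I ⊓ (J ⊔ M) = (I ⊓ J) ⊔ (I ⊓ M)) ∧
      ∃ e : Submodule (LeavittAlgebra K n) (LeavittAlgebra K n ⧸ LeavittAlgebra.leftIdeal p) ≃o P,
        ∀ d : RightFactor p,
          (e ((LeavittAlgebra.leftIdeal d.1).map (LeavittAlgebra.leftIdeal p).mkQ)).1 =
            Submodule.span (FreeAlgebra K (Fin n)) {d.1}) := by
  refine ⟨⟨Equiv.ofBijective _ (RightFactorClass.leftIdeal_bijective hp), fun d => rfl⟩,
    hp.factorLattice, fun I => hp.mem_factorLattice, hp.inf_sup_eq,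
    -- Submodules of 𝕃/𝕃p are left ideals above 𝕃p, which contraction carries to principal left
    -- ideals of Λ.
    (Submodule.comapMkQRelIso (LeavittAlgebra.leftIdeal p)).trans hp.contractionIso, fun d => ?_⟩
  change LeavittAlgebra.contraction (Submodule.comap _ (Submodule.map _ _)) = _
  obtain ⟨c, hc⟩ := d.2
  rw [Submodule.comap_map_mkQ, sup_eq_right.2 d.leftIdeal_le,
    LeavittAlgebra.contraction_leftIdeal (hp.algebraMapInv_ne_zero hc)]
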